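/- Let $B$ be a path connected, locally path connected and semilocally simply connected space with base point $b_0$, let $G=\pi_1(B,b_0)$, and let $\widetilde B\to B$ be the universal covering, whose points are the homotopy classes $[\alpha]$ of paths $\alpha$ starting at $b_0$; $G$ acts on $\widetilde B$ by $[\gamma]\cdot[\alpha]=[\gamma*\alpha]$. A *locally constant bundle* over $B$ with fibre $F$ is a locally trivial bundle $p:E\to B$ with fibre $F$ together with a homeomorphism $\Phi:\widetilde E=E\times_B\widetilde B\to F\times\widetilde B$ over $\widetilde B$ (a trivialization of the pull-back) whose transition functions are constant: for every $g\in G$ there is a map $\rho_g:F\to F$ such that, if $\Phi(e,a)=(x,a)$, then $\Phi(e,g\cdot a)=(\rho_g(x),g\cdot a)$. A continuous map $f:E_1\to E_2$ over $B$ between locally constant bundles is *locally constant* if there is a continuous map $h:F_1\to F_2$ such that the induced map $F_1\times\widetilde B\cong\widetilde E_1\to\widetilde E_2\cong F_2\times\widetilde B$ is $(x,a)\mapsto(h(x),a)$. A *locally constant sub-bundle* of $E$ is a subspace $R\subset E$ such that $R\to B$ has a structure of locally constant bundle for which the inclusion $R\to E$ is locally constant. The product $E\times_BE\to B$ is a locally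 constant bundle with fibre $F\times F$, trivialized by $\Phi$ in each factor. The group $G$, with the product given by concatenation of loops, acts on the right on the fibre $X=p^{-1}(b_0)$ by homeomorphisms: if $\Phi(e,[\mathrm{const}])=(x,[\mathrm{const}])$, then $e\cdot[\gamma]$ is the point of $X$ with $\Phi(e\cdot[\gamma],[\gamma])=(x,[\gamma])$, that is, the end of the lift of $\gamma$ that starts at $e$ and has constant $F$-coordinate. A relation $R$ *satisfies the axioms of a strict total order* on a product $P$ ($P=E\times_BE$ or $P=X\times X$) with diagonal $\Delta$ if $R\subset P$, $R\circ R\subset R$, $\Delta\cap R=\emptyset$, $R\cap R^{op}=\emptyset$ and $R\cup R^{op}=P\setminus\Delta$. The locally constant bundle $p:E\to B$ is *orderable* if there is a locally constant sub-bundle $R\subset E\times_BE$ that satisfies these axioms; the $G$-space $X$ is *orderable* if there is a $G$-invariant subspace $R\subset X\times X$ that satisfies them. **Proposition.** Let $p:E\to B$ be a locally constant bundle and $X$ its fibre over $b_0$. Then $p:E\to B$ is orderable as a bundle if and only if $X$ is orderable as a $G$-space. -/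

import Mathlib

open Topology

/-! ### The universal covering space -/

/-- A space is semilocally simply connected if every point `b` has a neighbourhood `U` such that
every loop at `b` inside `U` is null-homotopic in the whole space. -/
class SemilocallySimplyConnectedSpace (B : Type*) [TopologicalSpace B] : Prop where
  exists_nhds : ∀ b : B, ∃ U ∈ 𝓝 b, ∀ γ : Path b b, (∀ t, γ t ∈ U) → γ.Homotopic (Path.refl b)

/-- The points of the universal covering space of `(B, b₀)`: homotopy classes, relative to the
endpoints, of paths that start at `b₀`. -/
structure UniversalCover {B : Type*} [TopologicalSpace B] (b₀ : B) where
  /-- The covering map `[α] ↦ α(1)`. -/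
  proj : B
  /-- The homotopy class of the path. -/
  cls : Path.Homotopic.Quotient b₀ proj

namespace UniversalCover

variable {B : Type*} [TopologicalSpace B] {b₀ : B}

/-- The set of classes `[α * η]`, where `[α]` is given and `η` is a path inside `U`. -/
def basicNhd (a : UniversalCover b₀) (U : Set B) : Set (UniversalCover b₀) :=
  {c | ∃ η : Path a.proj c.proj, (∀ t, η t ∈ U) ∧
    c.cls = a.cls.trans (Path.Homotopic.Quotient.mk η)}

/-- The usual topology of the universal covering space: the sets `basicNhd a U` with `U` open
form a basis. -/
instance : TopologicalSpace (UniversalCover b₀) :=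
  TopologicalSpace.generateFrom {N | ∃ (a : UniversalCover b₀) (U : Set B),
    IsOpen U ∧ N = basicNhd a U}

/-- The point of the universal cover given by an element of the fundamental group. -/
def ofLoop (g : FundamentalGroup B b₀) : UniversalCover b₀ := ⟨b₀, FundamentalGroup.toPath g⟩

/-- The deck transformation `[α] ↦ [γ * α]` given by `g = [γ]` (`trans` is concatenation:
first `γ`, then `α`). -/
noncomputable def deck (g : FundamentalGroup B b₀) (a : UniversalCover b₀) : UniversalCover b₀ :=
  ⟨a.proj, (FundamentalGroup.toPath g).trans a.cls⟩

end UniversalCover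

/-! ### Locally constant bundles -/

/-- `p` is a locally trivial bundle with fibre `F`. -/
def IsLocallyTrivialBundle {B E : Type*} (F : Type*) [TopologicalSpace B] [TopologicalSpace E]
    [TopologicalSpace F] (p : E → B) : Prop :=
  Continuous p ∧ ∀ b : B, ∃ U : Set B, IsOpen U ∧ b ∈ U ∧
    IsHomeomorphicTrivialFiberBundle F (U.restrictPreimage p)

/-- A locally constant bundle with projection `p : E → B` and fibre `F`: a locally trivial bundle
together with a trivialization `Φ : Ẽ ≃ F × B̃` over `B̃` of its pull-back `Ẽ = E ×_B B̃` to the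
universal cover. The trivialization is what the notion of a locally constant map refers to. The
last field says that the transition functions are constant: the charts of `E` obtained from `Φ`
and from local sections of `B̃ → B` differ by deck transformations, and each deck transformation
`g` acts on `F × B̃` through a self-map `ρ` of `F` that does not depend on the point of `B̃`. -/
structure LocallyConstantBundle {B E : Type*} [TopologicalSpace B] [TopologicalSpace E]
    (b₀ : B) (F : Type*) [TopologicalSpace F] (p : E → B) where
  locallyTrivial : IsLocallyTrivialBundle F p
  /-- The trivialization of the pull-back to the universal cover. -/
  Φ : p.Pullback (UniversalCover.proj (b₀ := b₀)) ≃ₜ F × UniversalCover b₀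
  Φ_snd : ∀ z, (Φ z).2 = z.1.2
  constant_transition : ∀ g : FundamentalGroup B b₀, ∃ ρ : F → F,
    ∀ (e : E) (a : UniversalCover b₀) (h : p e = a.proj),
      (Φ ⟨(e, UniversalCover.deck g a), h⟩).1 = ρ (Φ ⟨(e, a), h⟩).1

/-- A continuous map `f : E₁ → E₂` over `B` is locally constant if the induced map
`F₁ × B̃ ≃ Ẽ₁ → Ẽ₂ ≃ F₂ × B̃` is `(x, a) ↦ (g x, a)` for a continuous map `g`. -/
def IsLocallyConstantMap {B E₁ E₂ F₁ F₂ : Type*} [TopologicalSpace B] [TopologicalSpace E₁]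
    [TopologicalSpace E₂] [TopologicalSpace F₁] [TopologicalSpace F₂] {b₀ : B}
    {p₁ : E₁ → B} {p₂ : E₂ → B} (L₁ : LocallyConstantBundle b₀ F₁ p₁)
    (L₂ : LocallyConstantBundle b₀ F₂ p₂) (f : E₁ → E₂) : Prop :=
  Continuous f ∧ ∃ hf : ∀ e, p₂ (f e) = p₁ e, ∃ g : F₁ → F₂, Continuous g ∧
    ∀ z : p₁.Pullback (UniversalCover.proj (b₀ := b₀)),
      L₂.Φ ⟨(f z.1.1, z.1.2), (hf _).trans z.2⟩ = (g (L₁.Φ z).1, z.1.2)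

namespace LocallyConstantBundle

universe u v w

variable {B : Type u} {E : Type v} {F : Type w} [TopologicalSpace B] [TopologicalSpace E]
  [TopologicalSpace F] {b₀ : B} {p : E → B}

/-- A locally constant sub-bundle: a subspace `R` of `E` such that `R → B` carries a structure of
locally constant bundle for which the inclusion `R → E` is a locally constant map. -/
def IsSubbundle (L : LocallyConstantBundle b₀ F p) (R : Set E) : Prop :=
  ∃ (F' : Type w) (_ : TopologicalSpace F')
    (L' : LocallyConstantBundle b₀ F' (fun e : R => p e)),
      IsLocallyConstantMap L' L (Subtype.val : R → E)

theorem symm_snd (L : LocallyConstantBundle b₀ F p) (x : F) (a : UniversalCover b₀) :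
    (L.Φ.symm (x, a)).1.2 = a := by
  rw [← L.Φ_snd, Homeomorph.apply_symm_apply]

theorem proj_symm (L : LocallyConstantBundle b₀ F p) (x : F) (a : UniversalCover b₀) :
    p (L.Φ.symm (x, a)).1.1 = a.proj :=
  (L.Φ.symm (x, a)).2.trans (by rw [L.symm_snd])

theorem apply_symm_fst (L : LocallyConstantBundle b₀ F p) (x : F) (a : UniversalCover b₀) :
    L.Φ ⟨((L.Φ.symm (x, a)).1.1, a), L.proj_symm x a⟩ = (x, a) := by
  have h : (⟨((L.Φ.symm (x, a)).1.1, a), L.proj_symm x a⟩ :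
      p.Pullback (UniversalCover.proj (b₀ := b₀))) = L.Φ.symm (x, a) :=
    Subtype.ext (Prod.ext rfl (L.symm_snd x a).symm)
  rw [h, Homeomorph.apply_symm_apply]

theorem coord_symm (L : LocallyConstantBundle b₀ F p) (x : F) (a : UniversalCover b₀) :
    (L.Φ ⟨((L.Φ.symm (x, a)).1.1, a), L.proj_symm x a⟩).1 = x := by
  rw [apply_symm_fst]

theorem symm_apply_fst (L : LocallyConstantBundle b₀ F p) (e : E) (a : UniversalCover b₀)
    (h : p e = a.proj) : (L.Φ.symm ((L.Φ ⟨(e, a), h⟩).1, a)).1.1 = e := by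
  have h' : ((L.Φ ⟨(e, a), h⟩).1, a) = L.Φ ⟨(e, a), h⟩ := Prod.ext rfl (L.Φ_snd ⟨(e, a), h⟩).symm
  rw [h', Homeomorph.symm_apply_apply]

/-! #### The fibre as a space with an action of the fundamental group -/

/-- The fibre of the bundle over the base point. -/
def Fibre (_ : LocallyConstantBundle b₀ F p) : Type v := {e : E // p e = b₀}

instance (L : LocallyConstantBundle b₀ F p) : TopologicalSpace L.Fibre :=
  inferInstanceAs (TopologicalSpace {e : E // p e = b₀})

/-- `L.transport e g` is the end point `e · [γ]` of the horizontal lift of the loop `γ`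
(`g = [γ]`) that starts at `e`. Horizontal means that the `F`-coordinate given by the
trivialization is constant along the lift: at the class of the constant loop it is that of `e`,
and the end point has the same coordinate at the class of `γ`. -/
noncomputable def transport (L : LocallyConstantBundle b₀ F p) (e : L.Fibre) (g : FundamentalGroup B b₀) :
    L.Fibre :=
  ⟨(L.Φ.symm ((L.Φ ⟨(e.1, UniversalCover.ofLoop 1), e.2⟩).1, UniversalCover.ofLoop g)).1.1,
    L.proj_symm _ _⟩

theorem coord_transport (L : LocallyConstantBundle b₀ F p) (e : L.Fibre)
    (g : FundamentalGroup B b₀) :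
    (L.Φ ⟨((L.transport e g).1, UniversalCover.ofLoop g), (L.transport e g).2⟩).1 =
      (L.Φ ⟨(e.1, UniversalCover.ofLoop 1), e.2⟩).1 :=
  L.coord_symm _ _

theorem fibre_ext (L : LocallyConstantBundle b₀ F p) {x y : L.Fibre}
    (g : FundamentalGroup B b₀)
    (h : (L.Φ ⟨(x.1, UniversalCover.ofLoop g), x.2⟩).1 =
      (L.Φ ⟨(y.1, UniversalCover.ofLoop g), y.2⟩).1) : x = y := by
  have hx := L.symm_apply_fst x.1 (UniversalCover.ofLoop g) x.2
  have hy := L.symm_apply_fst y.1 (UniversalCover.ofLoop g) y.2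
  rw [h] at hx
  exact Subtype.ext (hx.symm.trans hy)

theorem deck_ofLoop (g h : FundamentalGroup B b₀) :
    UniversalCover.deck g (UniversalCover.ofLoop h) = UniversalCover.ofLoop (h * g) := rfl

/-- The action of the fundamental group on the fibre, `g • e = e · [γ]` for `g = [γ]`. The product
`g * h` in `FundamentalGroup B b₀` is the class of the concatenation "first `h`, then `g`", so a
left action of this group is precisely a right action of the group of classes of loops with the
product given by concatenation in the order of writing. -/
noncomputable instance (L : LocallyConstantBundle b₀ F p) : MulAction (FundamentalGroup B b₀) L.Fibre where
  smul g e := L.transport e g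
  one_smul e := L.fibre_ext 1 (L.coord_transport e 1)
  mul_smul g h e := by
    obtain ⟨ρ, hρ⟩ := L.constant_transition h
    refine L.fibre_ext (g * h) ?_
    refine (L.coord_transport e (g * h)).trans ?_
    have h1 := hρ (L.transport (L.transport e h) g).1 (UniversalCover.ofLoop g)
      (L.transport (L.transport e h) g).2
    have h2 := hρ (L.transport e h).1 (UniversalCover.ofLoop 1) (L.transport e h).2
    simp only [deck_ofLoop, one_mul] at h1 h2
    refine Eq.trans ?_ h1.symm
    rw [L.coord_transport, ← h2, L.coord_transport]

instance (L : LocallyConstantBundle b₀ F p) :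
    ContinuousConstSMul (FundamentalGroup B b₀) L.Fibre where
  continuous_const_smul g := by
    change Continuous fun e : {e : E // p e = b₀} => (⟨(L.Φ.symm
      ((L.Φ ⟨(e.1, UniversalCover.ofLoop 1), e.2⟩).1, UniversalCover.ofLoop g)).1.1,
        L.proj_symm _ _⟩ : {e : E // p e = b₀})
    fun_prop

/-! #### The product of a locally constant bundle with itself -/

/-- The projection of `E ×_B E` to `B`. -/
def pairProj (p : E → B) (z : p.Pullback p) : B := p z.1.1

theorem isLocallyTrivialBundle_pair (hp : IsLocallyTrivialBundle F p) :
    IsLocallyTrivialBundle (F × F) (pairProj p) := by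
  obtain ⟨hc, ht⟩ := hp
  refine ⟨hc.comp (continuous_fst.comp continuous_subtype_val), fun b => ?_⟩
  obtain ⟨U, hU, hb, e, he⟩ := ht b
  have he2 : ∀ (u : U) (x : F), p (e.symm (u, x)).1 = u := fun u x => by
    have := he (e.symm (u, x))
    rw [Homeomorph.apply_symm_apply] at this
    exact (congrArg Subtype.val this).symm
  refine ⟨U, hU, hb,
    { toFun := fun z => (⟨p z.1.1.1, z.2⟩, ((e ⟨z.1.1.1, z.2⟩).2,
        (e ⟨z.1.1.2, Set.mem_preimage.2 (z.1.2 ▸ z.2)⟩).2))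
      invFun := fun y => ⟨⟨((e.symm (y.1, y.2.1)).1, (e.symm (y.1, y.2.2)).1), by
        rw [he2, he2]⟩, (e.symm (y.1, y.2.1)).2⟩
      left_inv := ?_
      right_inv := ?_
      continuous_toFun := by fun_prop
      continuous_invFun := by fun_prop }, fun z => rfl⟩
  · rintro ⟨⟨⟨x, y⟩, hxy⟩, hx⟩
    have key : ∀ (u : U) (x : E) (hx : p x ∈ U) (_ : p x = u),
        (e.symm (u, (e ⟨x, hx⟩).2)).1 = x := by
      intro u x hx hu
      have : (u, (e ⟨x, hx⟩).2) = e ⟨x, hx⟩ :=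
        Prod.ext ((Subtype.ext hu.symm).trans (he ⟨x, hx⟩).symm) rfl
      rw [this, Homeomorph.symm_apply_apply]
    refine Subtype.ext (Subtype.ext (Prod.ext ?_ ?_))
    · exact key _ _ _ rfl
    · exact key _ _ _ hxy.symm
  · rintro ⟨u, x, y⟩
    refine Prod.ext (Subtype.ext (he2 u x)) (Prod.ext ?_ ?_)
    · change (e (e.symm (u, x))).2 = x
      rw [Homeomorph.apply_symm_apply]
    · change (e (e.symm (u, y))).2 = y
      rw [Homeomorph.apply_symm_apply]

/-- The product `E ×_B E → B` as a locally constant bundle, with fibre `F × F`. -/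
noncomputable def pair (L : LocallyConstantBundle b₀ F p) :
    LocallyConstantBundle b₀ (F × F) (pairProj p) where
  locallyTrivial := isLocallyTrivialBundle_pair L.locallyTrivial
  Φ :=
    { toFun := fun z => (((L.Φ ⟨(z.1.1.1.1, z.1.2), z.2⟩).1,
        (L.Φ ⟨(z.1.1.1.2, z.1.2), z.1.1.2.symm.trans z.2⟩).1), z.1.2)
      invFun := fun y => ⟨(⟨((L.Φ.symm (y.1.1, y.2)).1.1, (L.Φ.symm (y.1.2, y.2)).1.1),
        (L.proj_symm _ _).trans (L.proj_symm _ _).symm⟩, y.2), L.proj_symm _ _⟩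
      left_inv := fun z => Subtype.ext (Prod.ext (Subtype.ext (Prod.ext
        (L.symm_apply_fst _ _ _) (L.symm_apply_fst _ _ _))) rfl)
      right_inv := fun y => Prod.ext (Prod.ext (L.coord_symm _ _) (L.coord_symm _ _)) rfl
      continuous_toFun := by fun_prop
      continuous_invFun := by fun_prop }
  Φ_snd _ := rfl
  constant_transition g := by
    obtain ⟨ρ, hρ⟩ := L.constant_transition g
    exact ⟨Prod.map ρ ρ, fun e a h => Prod.ext (hρ _ a h) (hρ _ a (e.2.symm.trans h))⟩

end LocallyConstantBundle

/-! ### Strict total orders -/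

open scoped SetRel in
/-- The axioms of a strict total order for a relation `R`, a subobject of the product `P` of an
object with itself. The underlying set of `P` is a set of pairs: all pairs for a space, the pairs
of points in the same fibre for a bundle. `SetRel.inv` is the opposite relation, `SetRel.id` is the
diagonal and `○` is composition. -/
structure IsStrictTotalOrderIn {X : Type*} (P R : SetRel X X) : Prop where
  subset : R ⊆ P
  transitive : R ○ R ⊆ R
  irreflexive : SetRel.id ∩ R = ∅
  antisymmetric : R ∩ R.inv = ∅
  total : R ∪ R.inv = P \ SetRel.id

/-- A `G`-space is orderable if there is a `G`-invariant subspace of `X × X` that satisfies the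
axioms of a strict total order. -/
def IsOrderableGSpace (G X : Type*) [Group G] [TopologicalSpace X] [MulAction G X]
    [ContinuousConstSMul G X] : Prop :=
  ∃ R : Set (X × X), (∀ (g : G), ∀ z ∈ R, g • z ∈ R) ∧ IsStrictTotalOrderIn Set.univ R

/-- A locally constant bundle is orderable if there is a locally constant sub-bundle `R` of
`E ×_B E` that satisfies the axioms of a strict total order. -/
def LocallyConstantBundle.IsOrderable {B E F : Type*} [TopologicalSpace B] [TopologicalSpace E]
    [TopologicalSpace F] {b₀ : B} {p : E → B} (L : LocallyConstantBundle b₀ F p) : Prop :=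
  ∃ R : Set (p.Pullback p), L.pair.IsSubbundle R ∧
    IsStrictTotalOrderIn {z : E × E | p z.1 = p z.2} (Subtype.val '' R)

/-! ### Deck transformations and local sections of the universal covering. -/

namespace UniversalCover

variable {B : Type*} [TopologicalSpace B] {b₀ : B}

/-! Coordinates over `B̃` reduce everything to the fibre. A subset `S` of `F × F` that is stable
under the transition functions cuts out a sub-bundle of `E ×_B E`, and reading coordinates at the
class of the constant loop identifies `F` with `X` so that these transition functions become the
action of `G` (`ofCoord_coord_deck`). The order axioms compare only points of one fibre, so they
pass through the coordinate bijections.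

From the bundle to `X`, horizontal transport inside `R` agrees with that in `E ×_B E`, because the
inclusion is constant in coordinates; hence the restriction of `R` to `X` is invariant. Conversely,
an invariant order on `X` is spread over `B` by `subspaceOf`; the result is locally trivial because
`B̃ → B` has local sections (`exists_local_section`). -/

theorem exists_proj_eq [PathConnectedSpace B] (b : B) : ∃ a : UniversalCover b₀, a.proj = b :=
  ⟨⟨b, Path.Homotopic.Quotient.mk (PathConnectedSpace.somePath b₀ b)⟩, rfl⟩

/-- The group of deck transformations acts transitively on the fibres of the universal cover. -/
theorem exists_deck_eq {a c : UniversalCover b₀} (h : a.proj = c.proj) :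
    ∃ g : FundamentalGroup B b₀, deck g a = c := by
  obtain ⟨b, α⟩ := a
  obtain ⟨b', γ⟩ := c
  obtain rfl : b = b' := h
  refine ⟨FundamentalGroup.fromPath (γ.trans α.symm), ?_⟩
  change (⟨b, (γ.trans α.symm).trans α⟩ : UniversalCover b₀) = ⟨b, γ⟩
  congr 1
  induction α using Path.Homotopic.Quotient.ind with | _ α
  induction γ using Path.Homotopic.Quotient.ind with | _ γ
  simp [Path.Homotopic.Quotient.trans_assoc]

/-- The universal covering has continuous local sections. -/
theorem exists_local_section [PathConnectedSpace B] [LocallyPathConnectedSpace B]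
    [SemilocallySimplyConnectedSpace B] (b : B) :
    ∃ U : Set B, IsOpen U ∧ b ∈ U ∧ ∃ s : U → UniversalCover b₀, Continuous s ∧
      ∀ u, (s u).proj = u := by
  obtain ⟨V, hV, hloop⟩ := SemilocallySimplyConnectedSpace.exists_nhds b
  obtain ⟨U, ⟨hU, hbU, hUc⟩, hUV⟩ := (isOpen_isPathConnected_basis b).mem_iff.1 hV
  have hjoin : ∀ u : U, ∃ η : Path b u, ∀ t, η t ∈ U := fun u => by
    obtain ⟨η, hη⟩ := hUc.joinedIn b hbU u u.2
    exact ⟨η, hη⟩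
  choose η hη using hjoin
  obtain ⟨⟨b', α⟩, rfl⟩ := exists_proj_eq (b₀ := b₀) b
  refine ⟨U, hU, hbU, fun u => ⟨u, α.trans (Path.Homotopic.Quotient.mk (η u))⟩, ?_,
    fun _ => rfl⟩
  refine continuous_generateFrom_iff.2 ?_
  rintro _ ⟨a, W, hW, rfl⟩
  rw [isOpen_iff_mem_nhds]
  rintro u ⟨ζ, hζ, hcls⟩
  have huW : (u : B) ∈ W := by simpa using hζ 1
  -- A path `ξ` from `u` to `v` in `N` does two jobs: it lies in `W`, so `ζ * ξ` witnesses
  -- membership in `basicNhd a W`; it lies in `U`, so the loop `η u * ξ * (η v)⁻¹` is null-homotopic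
  -- and `[η u * ξ] = [η v]`, whatever paths `η` were chosen.
  obtain ⟨N, ⟨hN, huN, hNc⟩, hNW⟩ :=
    (isOpen_isPathConnected_basis (u : B)).mem_iff.1 ((hW.inter hU).mem_nhds ⟨huW, u.2⟩)
  filter_upwards [(hN.preimage continuous_subtype_val).mem_nhds huN] with v hv
  obtain ⟨ξ, hξ⟩ := hNc.joinedIn u huN v hv
  refine ⟨ζ.trans ξ, ?_, ?_⟩
  · intro t
    have : ζ.trans ξ t ∈ Set.range ζ ∪ Set.range ξ := by
      rw [← Path.trans_range]; exact ⟨t, rfl⟩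
    rcases this with ⟨r, hr⟩ | ⟨r, hr⟩
    · exact hr ▸ hζ r
    · exact hr ▸ (hNW (hξ r)).1
  · have hl := hloop (((η u).trans ξ).trans (η v).symm) fun t => by
      apply hUV
      have : ((η u).trans ξ).trans (η v).symm t ∈
          (Set.range (η u) ∪ Set.range ξ) ∪ Set.range (η v).symm := by
        rw [← Path.trans_range, ← Path.trans_range]; exact ⟨t, rfl⟩
      rcases this with (⟨r, hr⟩ | ⟨r, hr⟩) | ⟨r, hr⟩
      · exact hr ▸ hη u r
      · exact hr ▸ (hNW (hξ r)).2
      · exact hr ▸ hη v _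
    have hl' : ((Path.Homotopic.Quotient.mk (η u)).trans (.mk ξ)).trans
        (Path.Homotopic.Quotient.mk (η v)).symm = .refl b' := Path.Homotopic.Quotient.eq.2 hl
    have key : (Path.Homotopic.Quotient.mk (η u)).trans (.mk ξ) = .mk (η v) := by
      have := congrArg (fun q => Path.Homotopic.Quotient.trans q (.mk (η v))) hl'
      simpa [Path.Homotopic.Quotient.trans_assoc] using this
    change α.trans (.mk (η v)) = a.cls.trans ((Path.Homotopic.Quotient.mk ζ).trans (.mk ξ))
    rw [← Path.Homotopic.Quotient.trans_assoc, ← hcls, Path.Homotopic.Quotient.trans_assoc, key]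

end UniversalCover

/-- Antisymmetry follows from transitivity and irreflexivity, and for symmetric `P` the inclusion of
`R ∪ R.inv` in `P \ SetRel.id` is automatic; neither needs separate treatment. -/
theorem isStrictTotalOrderIn_iff {X : Type*} {P R : SetRel X X}
    (hP : ∀ x y, (x, y) ∈ P → (y, x) ∈ P) :
    IsStrictTotalOrderIn P R ↔ R ⊆ P ∧ (∀ x y z, (x, y) ∈ R → (y, z) ∈ R → (x, z) ∈ R) ∧
      (∀ x, (x, x) ∉ R) ∧ ∀ x y, (x, y) ∈ P → x ≠ y → (x, y) ∈ R ∨ (y, x) ∈ R := by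
  constructor
  · rintro ⟨h1, h2, h3, -, h5⟩
    refine ⟨h1, fun x y z hxy hyz => h2 ⟨y, hxy, hyz⟩, fun x hx => ?_, fun x y hP hne => ?_⟩
    · exact (Set.ext_iff.1 h3 (x, x)).1 ⟨rfl, hx⟩
    · exact (Set.ext_iff.1 h5 (x, y)).2 ⟨hP, hne⟩
  · rintro ⟨h1, h2, h3, h4⟩
    refine ⟨h1, ?_, ?_, ?_, ?_⟩
    · rintro ⟨x, z⟩ ⟨y, hxy, hyz⟩
      exact h2 x y z hxy hyz
    · refine Set.eq_empty_of_forall_notMem ?_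
      rintro ⟨x, y⟩ ⟨hxy, h⟩
      obtain rfl : x = y := hxy
      exact h3 x h
    · refine Set.eq_empty_of_forall_notMem ?_
      rintro ⟨x, y⟩ ⟨hxy, hyx⟩
      exact h3 x (h2 x y x hxy hyx)
    · ext ⟨x, y⟩
      constructor
      · rintro (h | h)
        · exact ⟨h1 h, fun hxy => h3 x (by obtain rfl : x = y := hxy; exact h)⟩
        · exact ⟨hP _ _ (h1 h), fun hxy => h3 x (by obtain rfl : x = y := hxy; exact h)⟩
      · rintro ⟨hP, hne⟩
        exact h4 x y hP hne

/-! ### Sub-bundles from invariant subsets of the fibre. -/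

namespace LocallyConstantBundle

universe u v w

variable {B : Type u} {E : Type v} {F : Type w} [TopologicalSpace B] [TopologicalSpace E]
  [TopologicalSpace F] {b₀ : B} {p : E → B}

/-- The `F`-coordinate of `e` with respect to the point `a` of the universal cover. -/
noncomputable def coord (L : LocallyConstantBundle b₀ F p) (e : E) (a : UniversalCover b₀)
    (h : p e = a.proj) : F :=
  (L.Φ ⟨(e, a), h⟩).1

theorem coord_injective (L : LocallyConstantBundle b₀ F p) {e e' : E} {a : UniversalCover b₀}
    {h : p e = a.proj} {h' : p e' = a.proj} (he : L.coord e a h = L.coord e' a h') : e = e' := by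
  rw [← L.symm_apply_fst e a h, ← L.symm_apply_fst e' a h']
  exact congrArg (fun x => (L.Φ.symm (x, a)).1.1) he

theorem continuous_coord (L : LocallyConstantBundle b₀ F p) {Z : Type*} [TopologicalSpace Z]
    {f : Z → E} {s : Z → UniversalCover b₀} (hf : Continuous f) (hs : Continuous s)
    (h : ∀ z, p (f z) = (s z).proj) : Continuous fun z => L.coord (f z) (s z) (h z) :=
  continuous_fst.comp (L.Φ.continuous.comp ((hf.prodMk hs).subtype_mk h))

/-- The subspace of `E` of the points with coordinate in `S`. -/
def subspaceOf (L : LocallyConstantBundle b₀ F p) (S : Set F) : Set E :=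
  {e | ∃ (a : UniversalCover b₀) (h : p e = a.proj), L.coord e a h ∈ S}

/-- A subset of the fibre is invariant under the transition functions. -/
def IsTransitionInvariant (L : LocallyConstantBundle b₀ F p) (S : Set F) : Prop :=
  ∀ (g : FundamentalGroup B b₀) (e : E) (a : UniversalCover b₀) (h : p e = a.proj),
    L.coord e a h ∈ S → L.coord e (UniversalCover.deck g a) h ∈ S

/-- Two points of `B̃` over the same point of `B` differ by a deck transformation, so for invariant
`S` the "some `a`" in `subspaceOf` may be replaced by any given `a`. -/
theorem mem_subspaceOf_iff {L : LocallyConstantBundle b₀ F p} {S : Set F}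
    (hS : L.IsTransitionInvariant S) {e : E} {a : UniversalCover b₀} (h : p e = a.proj) :
    e ∈ L.subspaceOf S ↔ L.coord e a h ∈ S := by
  refine ⟨?_, fun hm => ⟨a, h, hm⟩⟩
  rintro ⟨c, hc, hm⟩
  obtain ⟨g, rfl⟩ := UniversalCover.exists_deck_eq (hc.symm.trans h)
  exact hS g e c hc hm

theorem symm_mem_subspaceOf (L : LocallyConstantBundle b₀ F p) {S : Set F} {x : F} (hx : x ∈ S)
    (a : UniversalCover b₀) : (L.Φ.symm (x, a)).1.1 ∈ L.subspaceOf S :=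
  ⟨a, L.proj_symm x a, by rw [coord, L.coord_symm]; exact hx⟩

section

variable [PathConnectedSpace B] [LocallyPathConnectedSpace B] [SemilocallySimplyConnectedSpace B]

/-- A local section `s` of `B̃ → B` turns `Φ` into a chart of `E`, with fibre coordinate taken at `s
(p e)`; by invariance of `S` this chart carries the subspace onto `U × S`. -/
theorem isLocallyTrivialBundle_subspaceOf (L : LocallyConstantBundle b₀ F p) {S : Set F}
    (hS : L.IsTransitionInvariant S) :
    IsLocallyTrivialBundle S (fun e : L.subspaceOf S => p e) := by
  have hp : Continuous p := L.locallyTrivial.1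
  refine ⟨hp.comp continuous_subtype_val, fun b => ?_⟩
  obtain ⟨U, hU, hb, s, hs, hsp⟩ := UniversalCover.exists_local_section (b₀ := b₀) b
  refine ⟨U, hU, hb,
    { toFun := fun z => (⟨p z.1.1, z.2⟩, ⟨L.coord z.1.1 (s ⟨p z.1.1, z.2⟩)
        (hsp ⟨p z.1.1, z.2⟩).symm, (mem_subspaceOf_iff hS _).1 z.1.2⟩)
      invFun := fun y => ⟨⟨(L.Φ.symm (y.2.1, s y.1)).1.1, L.symm_mem_subspaceOf y.2.2 _⟩, by
        change p _ ∈ U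
        rw [L.proj_symm, hsp]
        exact y.1.2⟩
      left_inv := fun z => Subtype.ext (Subtype.ext (L.symm_apply_fst _ _ _))
      right_inv := ?_
      continuous_toFun := by
        have hpU : Continuous fun z : (fun e : L.subspaceOf S => p e) ⁻¹' U =>
            (⟨p z.1.1, z.2⟩ : U) :=
          (hp.comp (continuous_subtype_val.comp continuous_subtype_val)).subtype_mk _
        exact hpU.prodMk ((L.continuous_coord
          (continuous_subtype_val.comp continuous_subtype_val) (hs.comp hpU) _).subtype_mk _)
      continuous_invFun := by fun_prop }, fun z => rfl⟩
  rintro ⟨u, x, hx⟩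
  have hpu : p (L.Φ.symm (x, s u)).1.1 = u := by rw [L.proj_symm, hsp]
  refine Prod.ext (Subtype.ext hpu) (Subtype.ext ?_)
  -- The section is evaluated at a base point that equals `u` only propositionally; generalizing to
  -- `v` makes the substitution possible in the dependent term.
  have key : ∀ (v : U) (hv : v = u) (h : p (L.Φ.symm (x, s u)).1.1 = (s v).proj),
      L.coord (L.Φ.symm (x, s u)).1.1 (s v) h = x := by
    rintro _ rfl h
    exact L.coord_symm x _
  exact key _ (Subtype.ext hpu) _

/-- The points with coordinate in an invariant subset `S` of the fibre form a locally constant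
bundle with fibre `S`. -/
noncomputable def restrict (L : LocallyConstantBundle b₀ F p) {S : Set F}
    (hS : L.IsTransitionInvariant S) :
    LocallyConstantBundle b₀ S (fun e : L.subspaceOf S => p e) where
  locallyTrivial := L.isLocallyTrivialBundle_subspaceOf hS
  Φ :=
    { toFun := fun z => (⟨L.coord z.1.1 z.1.2 z.2, (mem_subspaceOf_iff hS _).1 z.1.1.2⟩, z.1.2)
      invFun := fun y => ⟨(⟨(L.Φ.symm (y.1.1, y.2)).1.1, L.symm_mem_subspaceOf y.1.2 _⟩, y.2),
        L.proj_symm _ _⟩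
      left_inv := fun z => Subtype.ext (Prod.ext (Subtype.ext (L.symm_apply_fst _ _ _)) rfl)
      right_inv := fun y => Prod.ext (Subtype.ext (L.coord_symm _ _)) rfl
      continuous_toFun := ((L.continuous_coord
        (continuous_subtype_val.comp (continuous_fst.comp continuous_subtype_val))
        (continuous_snd.comp continuous_subtype_val) _).subtype_mk _).prodMk
          (continuous_snd.comp continuous_subtype_val)
      continuous_invFun := by fun_prop }
  Φ_snd _ := rfl
  constant_transition g := by
    obtain ⟨ρ, hρ⟩ := L.constant_transition g
    -- Any single point `a` suffices to see that `ρ` preserves `S`: every `x` is the coordinate at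
    -- `a` of some point, and `ρ` does not depend on `a`.
    obtain ⟨a, -⟩ := UniversalCover.exists_proj_eq (b₀ := b₀) b₀
    have hρS : ∀ x ∈ S, ρ x ∈ S := fun x hx => by
      have h := hS g _ a (L.proj_symm x a) (by rw [coord, L.coord_symm]; exact hx)
      have h' : L.coord _ (UniversalCover.deck g a) (L.proj_symm x a) = ρ x :=
        (hρ _ a (L.proj_symm x a)).trans (congrArg ρ (L.coord_symm x a))
      rwa [← h']
    exact ⟨fun x => ⟨ρ x, hρS x x.2⟩, fun e a h => Subtype.ext (hρ e a h)⟩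

theorem isSubbundle_subspaceOf (L : LocallyConstantBundle b₀ F p) {S : Set F}
    (hS : L.IsTransitionInvariant S) : L.IsSubbundle (L.subspaceOf S) :=
  ⟨S, inferInstance, L.restrict hS, continuous_subtype_val, fun _ => rfl, Subtype.val,
    continuous_subtype_val, fun _ => Prod.ext rfl (L.Φ_snd _)⟩

end

/-! ### The action of the fundamental group in coordinates. -/

theorem coord_smul (L : LocallyConstantBundle b₀ F p) (g : FundamentalGroup B b₀) (e : L.Fibre) :
    L.coord (g • e).1 (UniversalCover.ofLoop g) (g • e).2 =
      L.coord e.1 (UniversalCover.ofLoop 1) e.2 :=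
  L.coord_transport e g

/-- The point of the fibre over the base point with a given coordinate. -/
noncomputable def ofCoord (L : LocallyConstantBundle b₀ F p) (x : F) : L.Fibre :=
  ⟨(L.Φ.symm (x, UniversalCover.ofLoop 1)).1.1, L.proj_symm _ _⟩

theorem coord_ofCoord (L : LocallyConstantBundle b₀ F p) (x : F) :
    L.coord (L.ofCoord x).1 (UniversalCover.ofLoop 1) (L.ofCoord x).2 = x :=
  L.coord_symm _ _

theorem ofCoord_injective (L : LocallyConstantBundle b₀ F p) : Function.Injective L.ofCoord :=
  fun x y h => by
    rw [← L.coord_ofCoord x, ← L.coord_ofCoord y]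
    congr 2

/-- With `x` the coordinate of `e` at `a`, the point `g⁻¹ • ofCoord x` has coordinate `x` at the
class of `g⁻¹`. The deck transformation `g` moves that class to the constant loop, where the
coordinate is therefore `ρ x`. -/
theorem ofCoord_coord_deck (L : LocallyConstantBundle b₀ F p) (g : FundamentalGroup B b₀) (e : E)
    (a : UniversalCover b₀) (h : p e = a.proj) :
    L.ofCoord (L.coord e (UniversalCover.deck g a) h) = g⁻¹ • L.ofCoord (L.coord e a h) := by
  obtain ⟨ρ, hρ⟩ := L.constant_transition g
  refine L.fibre_ext 1 ((L.coord_ofCoord _).trans ?_)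
  have h1 := hρ (g⁻¹ • L.ofCoord (L.coord e a h)).1 (UniversalCover.ofLoop g⁻¹)
    (g⁻¹ • L.ofCoord (L.coord e a h)).2
  simp only [deck_ofLoop, inv_mul_cancel] at h1
  refine (hρ e a h).trans (Eq.trans ?_ h1.symm)
  exact congrArg ρ ((L.coord_smul _ _).trans (L.coord_ofCoord _)).symm

/-- Restricting an ordering of the bundle to the fibre over the base point. -/
theorem IsOrderable.isOrderableGSpace {L : LocallyConstantBundle b₀ F p} (hL : L.IsOrderable) :
    IsOrderableGSpace (FundamentalGroup B b₀) L.Fibre := by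
  obtain ⟨R, ⟨F', _, L', -, hf, k, -, hk⟩, hR⟩ := hL
  rw [isStrictTotalOrderIn_iff fun _ _ => Eq.symm] at hR
  obtain ⟨-, htrans, hirrefl, htotal⟩ := hR
  refine ⟨{z | (z.1.1, z.2.1) ∈ Subtype.val '' R}, ?_, ?_⟩
  · rintro g ⟨e, e'⟩ ⟨z, hz, hze⟩
    obtain ⟨⟨z1, z2⟩, hzp⟩ := z
    obtain ⟨rfl, rfl⟩ := Prod.ext_iff.1 hze
    let z : R := ⟨⟨(e.1, e'.1), hzp⟩, hz⟩
    let x' := L'.coord z (UniversalCover.ofLoop 1) e.2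
    -- Horizontal transport of the pair along `g`, carried out inside `R` with the trivialization of
    -- `L'`.
    let z' : R := (L'.Φ.symm (x', UniversalCover.ofLoop g)).1.1
    have hz'p : pairProj p z' = b₀ := L'.proj_symm x' (UniversalCover.ofLoop g)
    have hz'x : L'.coord z' (UniversalCover.ofLoop g) hz'p = x' := L'.coord_symm _ _
    have h1 := congrArg Prod.fst (hk ⟨(z, UniversalCover.ofLoop 1), e.2⟩)
    have h2 := congrArg Prod.fst (hk ⟨(z', UniversalCover.ofLoop g), hz'p⟩)
    -- The inclusion acts on coordinates by the one map `k`, so `z'` at `g` and `z` at the constant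
    -- loop have equal `F × F`-coordinates; this characterizes `(g • e, g • e')`.
    have h3 := h2.trans ((congrArg k hz'x).trans h1.symm)
    refine ⟨z'.1, z'.2, Prod.ext ?_ ?_⟩
    · exact L.coord_injective (a := UniversalCover.ofLoop g) (h := hz'p) (h' := (g • e).2)
        ((congrArg Prod.fst h3).trans (L.coord_smul g e).symm)
    · exact L.coord_injective (a := UniversalCover.ofLoop g) (h := z'.1.2.symm.trans hz'p)
        (h' := (g • e').2) ((congrArg Prod.snd h3).trans (L.coord_smul g e').symm)
  · rw [isStrictTotalOrderIn_iff fun _ _ _ => Set.mem_univ _]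
    exact ⟨Set.subset_univ _, fun x y z => htrans _ _ _, fun x => hirrefl _,
      fun x y _ hne => htotal _ _ (x.2.trans y.2.symm) fun h => hne (Subtype.ext h)⟩

/-- Spreading out an invariant ordering of the fibre over the base point. -/
theorem isOrderable_of_isOrderableGSpace [PathConnectedSpace B] [LocallyPathConnectedSpace B]
    [SemilocallySimplyConnectedSpace B] {L : LocallyConstantBundle b₀ F p}
    (hX : IsOrderableGSpace (FundamentalGroup B b₀) L.Fibre) : L.IsOrderable := by
  obtain ⟨R, hinv, hR⟩ := hX
  rw [isStrictTotalOrderIn_iff fun _ _ _ => Set.mem_univ _] at hR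
  obtain ⟨-, htrans, hirrefl, htotal⟩ := hR
  let S : Set (F × F) := {x | (L.ofCoord x.1, L.ofCoord x.2) ∈ R}
  have hS : L.pair.IsTransitionInvariant S := by
    intro g z a h hz
    have h1 := L.ofCoord_coord_deck g z.1.1 a h
    have h2 := L.ofCoord_coord_deck g z.1.2 a (z.2.symm.trans h)
    have hz' := hinv g⁻¹ _ hz
    exact (congrArg (· ∈ R) (Prod.ext h1 h2)).mpr hz'
  -- Points of one fibre can all be compared at a common `a`, which reduces each order axiom to the
  -- same axiom on `X`.
  have hmem : ∀ (x y : E) (a : UniversalCover b₀) (hx : p x = a.proj) (hy : p y = a.proj),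
      (x, y) ∈ Subtype.val '' L.pair.subspaceOf S ↔
        (L.ofCoord (L.coord x a hx), L.ofCoord (L.coord y a hy)) ∈ R := by
    intro x y a hx hy
    refine Iff.trans ?_ (mem_subspaceOf_iff hS (e := ⟨(x, y), hx.trans hy.symm⟩) hx)
    exact ⟨fun ⟨z, hz, h⟩ => (Subtype.ext h : z = ⟨(x, y), hx.trans hy.symm⟩) ▸ hz,
      fun h => ⟨_, h, rfl⟩⟩
  have hsub : ∀ x y, (x, y) ∈ Subtype.val '' L.pair.subspaceOf S → p x = p y := by
    rintro x y ⟨z, -, h⟩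
    have := z.2
    rwa [h] at this
  refine ⟨L.pair.subspaceOf S, L.pair.isSubbundle_subspaceOf hS, ?_⟩
  rw [isStrictTotalOrderIn_iff fun _ _ => Eq.symm]
  refine ⟨fun z hz => hsub z.1 z.2 hz, fun x y z hxy hyz => ?_, fun x hx => ?_,
    fun x y hxy hne => ?_⟩
  · obtain ⟨a, ha⟩ := UniversalCover.exists_proj_eq (b₀ := b₀) (p x)
    have hy := (hsub x y hxy).symm.trans ha.symm
    have hz := (hsub y z hyz).symm.trans hy
    rw [hmem x y a ha.symm hy] at hxy
    rw [hmem y z a hy hz] at hyz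
    exact (hmem x z a ha.symm hz).2 (htrans _ _ _ hxy hyz)
  · obtain ⟨a, ha⟩ := UniversalCover.exists_proj_eq (b₀ := b₀) (p x)
    exact hirrefl _ ((hmem x x a ha.symm ha.symm).1 hx)
  · obtain ⟨a, ha⟩ := UniversalCover.exists_proj_eq (b₀ := b₀) (p x)
    have hy : p y = a.proj := Eq.trans (Eq.symm hxy) ha.symm
    rw [hmem x y a ha.symm hy, hmem y x a hy ha.symm]
    exact htotal _ _ (Set.mem_univ _) fun h => hne (L.coord_injective (L.ofCoord_injective h))

end LocallyConstantBundle

theorem proposition3p7 {B E F : Type*} [TopologicalSpace B] [TopologicalSpace E]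
    [TopologicalSpace F] [PathConnectedSpace B] [LocallyPathConnectedSpace B]
    [SemilocallySimplyConnectedSpace B] (b₀ : B) (p : E → B)
    (L : LocallyConstantBundle b₀ F p) :
    L.IsOrderable ↔ IsOrderableGSpace (FundamentalGroup B b₀) L.Fibre :=
  ⟨fun h => h.isOrderableGSpace, fun h => LocallyConstantBundle.isOrderable_of_isOrderableGSpace h⟩
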